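/- Let $X$ be a locally compact Polish space and let $\mathbb{R}_+^*=(0,\infty)$ carry its usual topology. Put $\mathbb{X}:=\mathbb{R}_+^*\times X$, and let $\mathcal{B}_c(\cdot)$ denote the Borel sets with compact closure. Let $\mathbb{K}(X)$ be the cone of discrete Radon measures $\eta=\sum_i s_i\delta_{x_i}$ on $X$ (at most countably many distinct atoms $x_i\in X$, weights $s_i>0$, $\eta(K)<\infty$ for compact $K$; the zero measure is included), with the vague topology and its Borel $\sigma$-algebra. For $\eta\in\mathbb{K}(X)$ write $s_x:=s_x(\eta):=\eta(\{x\})$; for $\eta$-a.e. $x$ one has $s_x>0$. Let $\Gamma(\mathbb{X})$ be the set of all $\gamma\subset\mathbb{X}$ such that $\gamma\cap([a,b]\times\Lambda)$ is finite for all $0<a<b$ and $\Lambda\in\mathcal{B}_c(X)$. Identify $\gamma$ with the Radon measure $\sum_{y\in\gamma}\delta_y$ and equip $\Gamma(\mathbb{X})$ with the vague topology and its Borel $\sigma$-algebra. Let $\Pi(\mathbb{X})$ be the set of those $\gamma\in\Gamma(\mathbb{X})$ for which $(s_1,x),(s_2,x)\in\gamma$ implies $s_1=s_2$ and for which $\sum_{(s,x)\in\gamma}s\,\mathbf{1}_\Lambda(x)<\infty$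 for all $\Lambda\in\mathcal{B}_c(X)$. Let $\mathcal{R}:\Pi(\mathbb{X})\to\mathbb{K}(X)$, $\mathcal{R}(\gamma):=\sum_{(s,x)\in\gamma}s\,\delta_x$. Let $\nu$ and $\sigma$ be non-atomic nonnegative Radon measures on $\mathbb{R}_+^*$ and $X$, respectively, with $\int_{\mathbb{R}_+^*}s\,d\nu(s)<\infty$. Let $\pi_{\nu\otimes\sigma}$ be the Poisson measure on $\Gamma(\mathbb{X})$ with intensity $\nu\otimes\sigma$, i.e. the probability measure under which the numbers of points $|\gamma\cap B_i|$ in disjoint sets $B_1,\dots,B_n\in\mathcal{B}_c(\mathbb{X})$ are independent and each $|\gamma\cap B|$, $B\in\mathcal{B}_c(\mathbb{X})$, is Poisson distributed with mean $(\nu\otimes\sigma)(B)$. It is concentrated on $\Pi(\mathbb{X})$; let $\pi_{\mathbb{K},\nu\otimes\sigma}$ be the push-forward under $\mathcal{R}$ of its restriction to $\Pi(\mathbb{X})$. **Proposition (Mecke-type identity).** For every measurable function $F:\mathbb{K}(X)\times\mathbb{X}\to[0,+\infty]$ (in particular for every measurable $F$ with values in $[0,+\infty)$), $$\int_{\mathbb{K}(X)}\int_X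 F(\eta,s_x,x)\,d\eta(x)\,d\pi_{\mathbb{K},\nu\otimes\sigma}(\eta)=\int_{\mathbb{K}(X)}\int_X\int_{\mathbb{R}_+^*}s\,F(\eta+s\delta_x,s,x)\,d\nu(s)\,d\sigma(x)\,d\pi_{\mathbb{K},\nu\otimes\sigma}(\eta),$$ as an equality in $[0,+\infty]$. -/

import Mathlib

open MeasureTheory Set
open scoped ENNReal NNReal CompactlySupported

noncomputable section

namespace DiscreteRadon

/-- The half line `(0, ∞)`. Its topology as a subspace of `ℝ` is the one of the logarithmic metric
`|ln s₁ - ln s₂|`. -/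
abbrev PosReal : Type := Set.Ioi (0 : ℝ)

/-- Borel sets with compact closure. -/
def IsBoundedBorel {Y : Type*} [TopologicalSpace Y] [MeasurableSpace Y] (B : Set Y) : Prop :=
  MeasurableSet B ∧ IsCompact (closure B)

/-! ### Nonnegative Radon measures and the vague topology -/

/-- The cone of nonnegative Radon measures on `Y`, i.e. Borel measures that are finite on compact
sets (`Y` will always be a locally compact Polish space, where regularity is automatic). -/
def RadonMeasure (Y : Type*) [TopologicalSpace Y] [MeasurableSpace Y] : Type _ :=
  {μ : Measure Y // IsFiniteMeasureOnCompacts μ}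

/-- The vague topology: the coarsest one such that `μ ↦ ∫ f dμ` is continuous for every
`f ∈ C_c(Y)`. -/
instance RadonMeasure.instTopologicalSpace (Y : Type*) [TopologicalSpace Y] [MeasurableSpace Y] :
    TopologicalSpace (RadonMeasure Y) :=
  ⨅ f : C_c(Y, ℝ), TopologicalSpace.induced (fun μ => ∫ y, f y ∂μ.1) inferInstance

/-! ### The cone of discrete Radon measures -/

section Cone

variable {X : Type*} [TopologicalSpace X] [MeasurableSpace X]

/-- `η = ∑_{x ∈ T} s_x δ_x` with a countable (possibly empty) set `T` of (distinct) atoms and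
weights `s_x > 0`. -/
def IsDiscrete {X : Type*} [MeasurableSpace X] (η : Measure X) : Prop :=
  ∃ T : Set X, T.Countable ∧ ∃ s : T → PosReal,
    η = Measure.sum fun x : T => ENNReal.ofReal (s x : ℝ) • Measure.dirac (x : X)

variable (X) in
/-- The cone of nonnegative discrete Radon measures on `X`. -/
def Cone : Type _ := {η : RadonMeasure X // IsDiscrete η.1}

/-- The vague topology on the cone. -/
instance Cone.instTopologicalSpace : TopologicalSpace (Cone X) :=
  TopologicalSpace.induced Subtype.val inferInstance

/-- The Borel sigma-algebra of the vague topology. -/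
instance Cone.instMeasurableSpace : MeasurableSpace (Cone X) := borel (Cone X)

/-- The measure underlying an element of the cone. -/
def Cone.toMeasure (η : Cone X) : Measure X := η.1.1

/-- The weight `s_x(η) = η({x})` of the point `x`; the support of `η` is the set of all `x` with
`0 < η.weight x`. -/
def Cone.weight (η : Cone X) (x : X) : ℝ := (η.toMeasure {x}).toReal

theorem isDiscrete_of_countable {X : Type*} [MeasurableSpace X] [MeasurableSingletonClass X] {η : Measure X} {T : Set X}
    (hT : T.Countable) (h0 : η Tᶜ = 0) (hfin : ∀ x, η {x} < ∞) : IsDiscrete η := by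
  have hS : ({x ∈ T | η {x} ≠ 0}).Countable := hT.mono fun x hx => hx.1
  refine ⟨{x ∈ T | η {x} ≠ 0}, hS,
    fun x => ⟨(η {(x : X)}).toReal, ENNReal.toReal_pos x.2.2 (hfin _).ne⟩, ?_⟩
  have := hS.to_subtype
  have hnull : η {x ∈ T | η {x} ≠ 0}ᶜ = 0 := by
    have hsub : {x ∈ T | η {x} ≠ 0}ᶜ ⊆ Tᶜ ∪ {x ∈ T | η {x} = 0} := by
      intro x hx
      by_cases hxT : x ∈ T
      · right
        refine ⟨hxT, ?_⟩
        by_contra h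
        exact hx ⟨hxT, h⟩
      · exact Or.inl hxT
    refine measure_mono_null hsub (measure_union_null h0 ?_)
    have hc : ({x ∈ T | η {x} = 0}).Countable := hT.mono fun x hx => hx.1
    rw [← biUnion_of_singleton {x ∈ T | η {x} = 0}]
    exact (measure_biUnion_null_iff hc).2 fun x hx => hx.2
  ext A hA
  rw [Measure.sum_apply _ hA]
  have h1 : η A = η (A ∩ {x ∈ T | η {x} ≠ 0}) := by
    refine (measure_inter_conull ?_).symm
    exact measure_mono_null (Set.Subset.refl _) hnull
  have h2 : A ∩ {x ∈ T | η {x} ≠ 0} = ⋃ x : {x ∈ T | η {x} ≠ 0}, A ∩ {(x : X)} := by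
    rw [← inter_iUnion, iUnion_of_singleton_coe]
  rw [h1, h2, measure_iUnion]
  · refine tsum_congr fun x => ?_
    simp only [Measure.smul_apply, smul_eq_mul, Measure.dirac_apply' _ hA]
    rw [ENNReal.ofReal_toReal (hfin _).ne]
    by_cases hx : (x : X) ∈ A
    · simp [hx]
    · simp [hx]
  · intro x y hxy
    refine Set.disjoint_left.2 fun z hz hz' => hxy (Subtype.ext ?_)
    exact (hz.2 : z = x).symm.trans hz'.2
  · exact fun x => hA.inter (measurableSet_singleton _)

theorem IsDiscrete.exists_countable {X : Type*} [MeasurableSpace X] [MeasurableSingletonClass X] {η : Measure X}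
    (h : IsDiscrete η) : ∃ T : Set X, T.Countable ∧ η Tᶜ = 0 := by
  obtain ⟨T, hT, s, rfl⟩ := h
  refine ⟨T, hT, ?_⟩
  rw [Measure.sum_apply _ hT.measurableSet.compl]
  simp [Measure.dirac_apply' _ hT.measurableSet.compl]

/-- The measure `η + s δ_x`, as an element of the cone. -/
def Cone.addAtom [MeasurableSingletonClass X] (η : Cone X) (s : PosReal) (x : X) : Cone X :=
  ⟨⟨η.toMeasure + ENNReal.ofReal (s : ℝ) • Measure.dirac x, by
      refine ⟨fun K hK => ?_⟩
      have h1 : η.toMeasure K < ∞ := @IsCompact.measure_lt_top _ _ _ η.1.1 η.1.2 _ hK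
      have h2 : Measure.dirac x K < ∞ := measure_lt_top _ _
      rw [Measure.add_apply, Measure.smul_apply, smul_eq_mul]
      exact ENNReal.add_lt_top.2 ⟨h1, ENNReal.mul_lt_top ENNReal.ofReal_lt_top h2⟩⟩, by
    obtain ⟨T, hT, h0⟩ := η.2.exists_countable
    refine isDiscrete_of_countable (T := insert x T) (hT.insert x) ?_ fun y => ?_
    · have h1 : η.toMeasure (insert x T)ᶜ = 0 :=
        measure_mono_null (compl_subset_compl.2 (subset_insert x T)) h0
      have hm : MeasurableSet (insert x T)ᶜ := (hT.insert x).measurableSet.compl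
      simp [h1, Measure.dirac_apply' _ hm]
    · have h1 : η.toMeasure {y} < ∞ :=
        @IsCompact.measure_lt_top _ _ _ η.1.1 η.1.2 _ isCompact_singleton
      have h2 : Measure.dirac x {y} < ∞ := measure_lt_top _ _
      rw [Measure.add_apply, Measure.smul_apply, smul_eq_mul]
      exact ENNReal.add_lt_top.2 ⟨h1, ENNReal.mul_lt_top ENNReal.ofReal_lt_top h2⟩⟩

end Cone

/-! ### Configurations over `(0, ∞) × X` -/

section Configuration

variable {X : Type*} [TopologicalSpace X] [MeasurableSpace X]

variable (X) in
/-- The space of locally finite configurations over `(0, ∞) × X`. -/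
def Configuration : Type _ :=
  {γ : Set (PosReal × X) // ∀ Λ : Set X, IsBoundedBorel Λ → ∀ a b : PosReal, a < b →
    (γ ∩ (Icc a b ×ˢ Λ)).Finite}

/-- The measure `∑_{y ∈ γ} δ_y`. -/
def Configuration.toMeasure (γ : Configuration X) : Measure (PosReal × X) :=
  Measure.sum fun y : γ.1 => Measure.dirac (y : PosReal × X)

theorem Configuration.finite_inter_compact [T2Space X] [BorelSpace X] (γ : Configuration X)
    {K : Set (PosReal × X)} (hK : IsCompact K) : (γ.1 ∩ K).Finite := by
  have hL : IsCompact (Prod.snd '' K) := hK.image continuous_snd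
  have hI : IsCompact (Prod.fst '' K) := hK.image continuous_fst
  rcases K.eq_empty_or_nonempty with rfl | hne
  · simp
  obtain ⟨a, ha⟩ := hI.bddBelow_image (f := id) continuousOn_id
  obtain ⟨b, hb⟩ := hI.bddAbove_image (f := id) continuousOn_id
  simp only [image_id] at ha hb
  have hab : a ≤ b := by
    obtain ⟨p, hp⟩ := hne
    exact (ha ⟨p, hp, rfl⟩).trans (hb ⟨p, hp, rfl⟩)
  have hb' : b < ⟨b.1 + 1, mem_Ioi.2 (add_pos b.2 one_pos)⟩ := Subtype.mk_lt_mk.2 (by simp)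
  refine (γ.2 (Prod.snd '' K) ⟨hL.measurableSet, by rwa [hL.isClosed.closure_eq]⟩ a _
    (hab.trans_lt hb')).subset ?_
  rintro p ⟨hp, hpK⟩
  exact ⟨hp, ⟨ha ⟨p, hpK, rfl⟩, (hb ⟨p, hpK, rfl⟩).trans hb'.le⟩, ⟨p, hpK, rfl⟩⟩

instance : LocallyCompactSpace PosReal := isOpen_Ioi.locallyCompactSpace

theorem Configuration.countable [PolishSpace X] [LocallyCompactSpace X] [BorelSpace X]
    (γ : Configuration X) : γ.1.Countable := by
  have h : γ.1 = ⋃ n, γ.1 ∩ compactCovering (PosReal × X) n := by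
    rw [← inter_iUnion, iUnion_compactCovering, inter_univ]
  rw [h]
  exact countable_iUnion fun n =>
    (γ.finite_inter_compact (isCompact_compactCovering _ n)).countable

/-- A configuration, identified with the Radon measure `∑_{y ∈ γ} δ_y`. -/
def Configuration.toRadon [PolishSpace X] [BorelSpace X] (γ : Configuration X) :
    RadonMeasure (PosReal × X) :=
  ⟨γ.toMeasure, ⟨fun K hK => by
    have hfin := γ.finite_inter_compact hK
    rw [Configuration.toMeasure, Measure.sum_apply _ hK.measurableSet]
    have hs : (Function.support fun y : γ.1 => Measure.dirac (y : PosReal × X) K).Finite := by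
      refine Set.Finite.subset (hfin.preimage Subtype.val_injective.injOn) fun y hy => ?_
      by_contra hyK
      refine hy ?_
      have : (y : PosReal × X) ∉ K := fun h => hyK ⟨y.2, h⟩
      simp [Measure.dirac_apply' _ hK.measurableSet, this]
    rw [tsum_eq_sum (s := hs.toFinset) (fun y hy => by simpa using hy)]
    exact ENNReal.sum_lt_top.2 fun y _ => measure_lt_top _ _⟩⟩

/-- The vague topology on configurations. -/
instance Configuration.instTopologicalSpace [PolishSpace X] [BorelSpace X] :
    TopologicalSpace (Configuration X) :=
  TopologicalSpace.induced Configuration.toRadon inferInstance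

/-- The Borel sigma-algebra of the vague topology. -/
instance Configuration.instMeasurableSpace [PolishSpace X] [BorelSpace X] :
    MeasurableSpace (Configuration X) := borel (Configuration X)

/-- The number of points of a configuration in `B` (finite if `B` is a bounded Borel set). -/
def Configuration.count (γ : Configuration X) (B : Set (PosReal × X)) : ℕ := (γ.1 ∩ B).ncard

/-- Pinpointing configurations: distinct points of `γ` have distinct second coordinates. -/
def Configuration.IsPinpointing (γ : Configuration X) : Prop :=
  ∀ p ∈ γ.1, ∀ q ∈ γ.1, p.2 = q.2 → p.1 = q.1

/-- The local mass `γ(Λ) = ∫ s 1_Λ(x) dγ(s, x)`. -/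
def Configuration.localMass (γ : Configuration X) (Λ : Set X) : ℝ≥0∞ :=
  ∫⁻ p, ENNReal.ofReal (p.1 : ℝ) * Λ.indicator 1 p.2 ∂γ.toMeasure

variable (X) in
/-- The set of pinpointing configurations with finite local mass. Its coercion to a type carries
the trace sigma-algebra. -/
def pinpointingFinite : Set (Configuration X) :=
  {γ | γ.IsPinpointing ∧ ∀ Λ : Set X, IsBoundedBorel Λ → γ.localMass Λ < ∞}

/-- The measure `∑_{(s, x) ∈ γ} s δ_x`. -/
def Configuration.toConeMeasure (γ : Configuration X) : Measure X :=
  Measure.sum fun p : γ.1 => ENNReal.ofReal (p.1.1 : ℝ) • Measure.dirac p.1.2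

theorem Configuration.toConeMeasure_apply (γ : Configuration X) {A : Set X}
    (hA : MeasurableSet A) : γ.toConeMeasure A = γ.localMass A := by
  have hm : Measurable fun p : PosReal × X =>
      ENNReal.ofReal (p.1 : ℝ) * A.indicator (1 : X → ℝ≥0∞) p.2 :=
    (ENNReal.measurable_ofReal.comp (measurable_subtype_coe.comp measurable_fst)).mul
      ((measurable_one.indicator hA).comp measurable_snd)
  rw [toConeMeasure, localMass, toMeasure, Measure.sum_apply _ hA, lintegral_sum_measure]
  refine tsum_congr fun p => ?_
  rw [lintegral_dirac' _ hm]
  simp [Measure.dirac_apply' _ hA]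

/-- The map `γ ↦ ∑_{(s, x) ∈ γ} s δ_x` from pinpointing configurations with finite local mass to
the cone. -/
def toCone [PolishSpace X] [LocallyCompactSpace X] [BorelSpace X] (γ : pinpointingFinite X) :
    Cone X :=
  ⟨⟨γ.1.toConeMeasure, ⟨fun K hK => by
      rw [γ.1.toConeMeasure_apply hK.measurableSet]
      exact γ.2.2 K ⟨hK.measurableSet, by rwa [hK.isClosed.closure_eq]⟩⟩⟩, by
    have hT : (Prod.snd '' γ.1.1).Countable := γ.1.countable.image _
    refine isDiscrete_of_countable (T := Prod.snd '' γ.1.1) hT ?_ fun x => ?_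
    · have hm := hT.measurableSet.compl
      show γ.1.toConeMeasure _ = 0
      rw [Configuration.toConeMeasure, Measure.sum_apply _ hm, ENNReal.tsum_eq_zero]
      intro p
      have hp : p.1.2 ∈ Prod.snd '' γ.1.1 := ⟨p.1, p.2, rfl⟩
      rw [Measure.smul_apply, Measure.dirac_apply' _ hm,
        Set.indicator_of_notMem (Set.notMem_compl_iff.2 hp), smul_zero]
    · show γ.1.toConeMeasure _ < ∞
      rw [γ.1.toConeMeasure_apply (measurableSet_singleton x)]
      exact γ.2.2 {x} ⟨measurableSet_singleton x, by simp⟩⟩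

/-- `π` is the Poisson measure on configurations with intensity measure `m`: the numbers of points
in disjoint bounded Borel sets are independent, and the number of points in a bounded Borel set `B`
has the Poisson distribution with mean `m B`. -/
structure IsPoissonMeasure [PolishSpace X] [BorelSpace X] (m : Measure (PosReal × X))
    (π : Measure (Configuration X)) : Prop where
  isProbabilityMeasure : IsProbabilityMeasure π
  hasLaw_count : ∀ B : Set (PosReal × X), IsBoundedBorel B →
    ProbabilityTheory.HasLaw (fun γ : Configuration X => γ.count B)
      (ProbabilityTheory.poissonMeasure (m B).toNNReal) π
  iIndepFun_count : ∀ (n : ℕ) (B : Fin n → Set (PosReal × X)), (∀ i, IsBoundedBorel (B i)) →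
    Pairwise (fun i j => Disjoint (B i) (B j)) →
    ProbabilityTheory.iIndepFun (fun i (γ : Configuration X) => γ.count (B i)) π

/-- The push-forward to the cone, under `γ ↦ ∑_{(s, x) ∈ γ} s δ_x`, of (the restriction to the
pinpointing configurations with finite local mass of) a measure `π` on configurations. -/
def coneLaw [PolishSpace X] [LocallyCompactSpace X] [BorelSpace X]
    (π : Measure (Configuration X)) : Measure (Cone X) :=
  (π.comap (Subtype.val : pinpointingFinite X → Configuration X)).map toCone

end Configuration

end DiscreteRadon

end

open DiscreteRadon

open Filter Topology ProbabilityTheory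

namespace DiscreteRadon

/-! The identity is the Mecke equation of the Poisson measure, transported by `toCone`. If η is the
image of a pinpointing γ, the atoms of η are the points x with (s, x) ∈ γ and the weight at x is s.
Integrating against η is therefore summing over γ with the extra factor s. Adding s δ_x to η amounts
to adding (s, x) to γ, provided x is not yet the location of a point of γ.

The Mecke equation rests on the recursion (k + 1) P(k + 1) = r P(k) of the Poisson weights.
Independence extends it to counts in disjoint bounded sets, passing to atoms to counts in arbitrary
finite families (`lintegral_count_mul_of_finite`), and a π-system argument to all measurable
functions (`compProd_eq_map_insertPoint`, `lintegral_lintegral_toMeasure`).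

The exceptional sets are null since σ has no atoms and configurations are countable. Applied to
collisions and to local masses, the same Mecke equation shows that the Poisson measure is
concentrated on `pinpointingFinite X`.

Measurability is the remaining burden: the vague Borel σ-algebras are those generated by the
evaluations μ ↦ μ(B), and the evaluation kernels are s-finite. This makes point masses,
`insertPoint` and `addAtom` jointly measurable. -/

theorem measurable_integral_of_measurable {Y Ω : Type*} [MeasurableSpace Y]
    [MeasurableSpace Ω] {μ : Ω → Measure Y}
    (hμ : Measurable μ) {f : Y → ℝ} (hf : Measurable f) (hfi : ∀ ω, Integrable f (μ ω)) :
    Measurable fun ω => ∫ y, f y ∂(μ ω) := by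
  simp_rw [fun ω => integral_eq_lintegral_pos_part_sub_lintegral_neg_part (hfi ω)]
  exact ((Measure.measurable_lintegral (by fun_prop)).comp hμ).ennreal_toReal.sub
    ((Measure.measurable_lintegral (by fun_prop)).comp hμ).ennreal_toReal

/-! ### The Borel σ-algebra of the vague topology -/

section Vague

variable {Y : Type*} [TopologicalSpace Y]

/-- A compactly supported cutoff function which is `1` on a given compact set. -/
theorem exists_cutoff [T2Space Y] [LocallyCompactSpace Y] {K : Set Y} (hK : IsCompact K) :
    ∃ g : C_c(Y, ℝ), (∀ y ∈ K, g y = 1) ∧ ∀ y, 0 ≤ g y := by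
  obtain ⟨g, h1, -, h2, h3⟩ := exists_continuous_one_zero_of_isCompact hK isClosed_empty
    (disjoint_empty K)
  exact ⟨⟨g, h2⟩, fun y hy => h1 hy, fun y => (h3 y).1⟩

/-- Uniform approximation of compactly supported functions by countably many of them, on compact
sets which contain the supports. -/
theorem exists_countable_approx (Y : Type*) [TopologicalSpace Y] [T2Space Y]
    [LocallyCompactSpace Y] [SecondCountableTopology Y] :
    ∃ D : Set C_c(Y, ℝ), D.Countable ∧ ∀ f : C_c(Y, ℝ), ∃ K : Set Y, IsCompact K ∧
      (∃ g ∈ D, (∀ y ∈ K, g y = 1) ∧ ∀ y, 0 ≤ g y) ∧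
      ∀ ε > 0, ∃ d ∈ D, (∀ y ∈ K, |d y - f y| < ε) ∧ ∀ y ∉ K, d y = 0 ∧ f y = 0 := by
  let E := CompactExhaustion.choice Y
  choose g hg1 hg0 using fun n => exists_cutoff (E.isCompact n)
  -- In the compact-open topology these sets of functions are separable, and uniform closeness on
  -- the compact `E n` is an open condition. Fixing the compact set also keeps the supports of the
  -- approximants under control.
  let S : ℕ → Set C(Y, ℝ) := fun n => {h | tsupport h ⊆ E n}
  choose T hTc hTd using fun n => TopologicalSpace.exists_countable_dense (S n)
  let ι : ∀ n, S n → C_c(Y, ℝ) := fun n h => ⟨h.1, (E.isCompact n).of_isClosed_subset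
    (isClosed_tsupport _) h.2⟩
  refine ⟨range g ∪ ⋃ n, ι n '' T n, (countable_range g).union
    (countable_iUnion fun n => (hTc n).image _), fun f => ?_⟩
  obtain ⟨n, hn⟩ := E.exists_superset_of_isCompact f.2
  refine ⟨E n, E.isCompact n, ⟨g n, Or.inl ⟨n, rfl⟩, hg1 n, hg0 n⟩, fun ε hε => ?_⟩
  have hU : IsOpen {h : S n | MapsTo (h.1 - f.1) (E n) (Metric.ball 0 ε)} :=
    (ContinuousMap.isOpen_setOfPred_mapsTo (E.isCompact n) Metric.isOpen_ball).preimage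
      (continuous_subtype_val.sub continuous_const)
  obtain ⟨d, hdT, hd⟩ := (hTd n).exists_mem_open hU ⟨⟨f.1, hn⟩, fun y _ => by simp [hε]⟩
  refine ⟨ι n d, Or.inr (mem_iUnion.2 ⟨n, d, hdT, rfl⟩), fun y hy => ?_, fun y hy =>
    ⟨image_eq_zero_of_notMem_tsupport fun h => hy (d.2 h),
      image_eq_zero_of_notMem_tsupport fun h => hy (hn h)⟩⟩
  exact mem_ball_zero_iff.1 (hd hy)

variable [MeasurableSpace Y]

instance (μ : RadonMeasure Y) : IsFiniteMeasureOnCompacts μ.1 := μ.2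

theorem integrable_compactlySupported [BorelSpace Y] (μ : RadonMeasure Y) (f : C_c(Y, ℝ)) :
    Integrable (fun y => f y) μ.1 :=
  f.1.continuous.integrable_of_hasCompactSupport f.2

theorem continuous_integral_compactlySupported (f : C_c(Y, ℝ)) :
    Continuous fun μ : RadonMeasure Y => ∫ y, f y ∂μ.1 :=
  continuous_iInf_dom (i := f) continuous_induced_dom

variable [T2Space Y] [LocallyCompactSpace Y] [SecondCountableTopology Y] [BorelSpace Y]

/-- The vague topology is induced by countably many compactly supported functions. -/
theorem exists_countable_vagueTopology_eq_induced :
    ∃ D : Set C_c(Y, ℝ), D.Countable ∧ RadonMeasure.instTopologicalSpace Y =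
      TopologicalSpace.induced (fun μ (f : D) => ∫ y, f.1 y ∂μ.1) inferInstance := by
  obtain ⟨D, hDc, hD⟩ := exists_countable_approx Y
  refine ⟨D, hDc, le_antisymm ?_ (le_iInf fun f => ?_)⟩
  · rw [← continuous_iff_le_induced]
    exact continuous_pi fun f : D => continuous_integral_compactlySupported f.1
  rw [← continuous_iff_le_induced]
  let τ : TopologicalSpace (RadonMeasure Y) :=
    TopologicalSpace.induced (fun μ (f : D) => ∫ y, f.1 y ∂μ.1) inferInstance
  have hcont : ∀ d ∈ D, Continuous[τ, _] fun μ : RadonMeasure Y => ∫ y, d y ∂μ.1 :=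
    fun d hd => (continuous_apply (⟨d, hd⟩ : D)).comp
      (continuous_induced_dom (f := fun (μ : RadonMeasure Y) (f : D) => ∫ y, f.1 y ∂μ.1))
  obtain ⟨K, hK, ⟨g, hgD, hg1, hg0⟩, happ⟩ := hD f
  refine (@continuous_iff_continuousAt _ _ τ _ _).2 fun μ₀ => ?_
  refine Metric.tendsto_nhds.2 fun ε hε => ?_
  set G := ∫ y, g y ∂μ₀.1 with hG
  have hG0 : 0 ≤ G := integral_nonneg hg0
  -- Replacing f by d costs at most δ (G + 1) at μ, where ∫ g dμ < G + 1, and δ G at μ₀; the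
  -- integrals of d differ by less than δ. The total is below δ (2 G + 3) = ε.
  obtain ⟨d, hdD, hd, hd0⟩ := happ (ε / (2 * G + 3)) (by positivity)
  set δ := ε / (2 * G + 3) with hδ
  have hδ0 : 0 < δ := by positivity
  have hεδ : ε = δ * (2 * G + 3) := by rw [hδ]; field_simp
  have hbound : ∀ μ : RadonMeasure Y, |∫ y, d y ∂μ.1 - ∫ y, f y ∂μ.1| ≤ δ * ∫ y, g y ∂μ.1 := by
    intro μ
    rw [← integral_sub (integrable_compactlySupported μ d) (integrable_compactlySupported μ f),
      ← integral_const_mul, ← Real.norm_eq_abs]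
    refine norm_integral_le_of_norm_le ((integrable_compactlySupported μ g).const_mul δ)
      (Eventually.of_forall fun y => ?_)
    by_cases hy : y ∈ K
    · rw [hg1 y hy, mul_one]
      exact (hd y hy).le
    · rw [(hd0 y hy).1, (hd0 y hy).2]
      simpa using mul_nonneg hδ0.le (hg0 y)
  have h1 := Metric.tendsto_nhds.1 ((@continuous_iff_continuousAt _ _ τ _ _).1 (hcont d hdD) μ₀)
    δ hδ0
  have h2 := Metric.tendsto_nhds.1 ((@continuous_iff_continuousAt _ _ τ _ _).1 (hcont g hgD) μ₀)
    1 one_pos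
  filter_upwards [h1, h2] with μ h1 h2
  rw [Real.dist_eq] at *
  have e1 := abs_le.1 (hbound μ)
  have e2 := abs_le.1 (hbound μ₀)
  have e3 := abs_lt.1 h1
  have e4 := abs_lt.1 h2
  have e5 : δ * ∫ y, g y ∂μ.1 ≤ δ * (G + 1) :=
    mul_le_mul_of_nonneg_left (by linarith) hδ0.le
  rw [abs_lt]
  constructor <;> nlinarith

/-- Countability of the inducing family is what matters: the Borel σ-algebra of the countable power
of ℝ is the product one, so measurability can be tested on each integral separately. -/
theorem borel_radonMeasure_le :
    borel (RadonMeasure Y) ≤ MeasurableSpace.comap Subtype.val (inferInstance :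
      MeasurableSpace (Measure Y)) := by
  obtain ⟨D, hDc, hD⟩ := exists_countable_vagueTopology_eq_induced (Y := Y)
  have := hDc.to_subtype
  rw [hD, borel_comap, ← (inferInstance : BorelSpace (D → ℝ)).measurable_eq]
  let _ : MeasurableSpace (RadonMeasure Y) :=
    MeasurableSpace.comap Subtype.val (inferInstance : MeasurableSpace (Measure Y))
  refine measurable_iff_comap_le.1 (measurable_pi_lambda _ fun f : D => ?_)
  exact measurable_integral_of_measurable (comap_measurable _) f.1.1.continuous.measurable
    fun μ : RadonMeasure Y => integrable_compactlySupported μ f.1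

/-- The Borel sigma-algebra of the vague topology. -/
noncomputable instance RadonMeasure.instMeasurableSpace : MeasurableSpace (RadonMeasure Y) := borel _

instance : BorelSpace (RadonMeasure Y) := ⟨rfl⟩

/-- The weight g turns μ into a finite measure, to which the π-system of closed sets applies. It
also makes every continuous h an admissible test function, because g h has compact support; closed
sets are then reached by continuous approximation of their indicators. -/
theorem measurable_withDensity_cutoff (g : C_c(Y, ℝ)) (hg : ∀ y, 0 ≤ g y) :
    Measurable fun μ : RadonMeasure Y => μ.1.withDensity fun y => ENNReal.ofReal (g y) := by
  have hgm : Measurable fun y => ENNReal.ofReal (g y) :=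
    ENNReal.measurable_ofReal.comp g.1.continuous.measurable
  have hfin : ∀ μ : RadonMeasure Y,
      IsFiniteMeasure (μ.1.withDensity fun y => ENNReal.ofReal (g y)) := fun μ =>
    isFiniteMeasure_withDensity_ofReal (integrable_compactlySupported μ g).2
  have hprod : ∀ h : Y → ℝ≥0, Continuous h → Measurable fun μ : RadonMeasure Y =>
      ∫⁻ y, h y ∂(μ.1.withDensity fun y => ENNReal.ofReal (g y)) := by
    intro h hh
    let k : C_c(Y, ℝ) := ⟨⟨fun y => g y * h y, g.1.continuous.mul
      (NNReal.continuous_coe.comp hh)⟩, g.2.mul_right⟩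
    have hk : ∀ μ : RadonMeasure Y,
        ∫⁻ y, h y ∂(μ.1.withDensity fun y => ENNReal.ofReal (g y)) =
          ENNReal.ofReal (∫ y, k y ∂μ.1) := by
      intro μ
      rw [lintegral_withDensity_eq_lintegral_mul _ hgm hh.measurable.coe_nnreal_ennreal,
        ofReal_integral_eq_lintegral_ofReal (integrable_compactlySupported μ k)
          (Eventually.of_forall fun y => mul_nonneg (hg y) (h y).2)]
      refine lintegral_congr fun y => ?_
      change _ = ENNReal.ofReal (g y * h y)
      rw [ENNReal.ofReal_mul (hg y)]
      simp
    simp_rw [hk]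
    exact ENNReal.measurable_ofReal.comp (continuous_integral_compactlySupported k).measurable
  refine Measurable.measure_of_isPiSystem (S := {s | IsClosed s})
    (BorelSpace.measurable_eq.trans borel_eq_generateFrom_isClosed) isPiSystem_isClosed
    (fun F hF => ?_) ?_
  · exact measurable_of_tendsto_metrizable (fun n => hprod _ (hF.apprSeq n).continuous)
      (tendsto_pi_nhds.2 fun μ => HasOuterApproxClosed.tendsto_lintegral_apprSeq hF _)
  · simpa using hprod 1 continuous_const

/-- The evaluation maps of Radon measures are Borel measurable. -/
theorem measurable_radonMeasure_val : Measurable fun μ : RadonMeasure Y => μ.1 := by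
  refine Measure.measurable_of_measurable_coe _ fun B hB => ?_
  have key : ∀ n, Measurable fun μ : RadonMeasure Y => μ.1 (B ∩ compactCovering Y n) := by
    intro n
    obtain ⟨g, hg1, hg0⟩ := exists_cutoff (isCompact_compactCovering Y n)
    have hm : MeasurableSet (B ∩ compactCovering Y n) :=
      hB.inter (isCompact_compactCovering Y n).measurableSet
    -- Since g = 1 on the compact set, the weighted measure agrees with μ on its subsets.
    convert (Measure.measurable_coe hm).comp (measurable_withDensity_cutoff g hg0) using 2 with μ
    rw [Function.comp, withDensity_apply _ hm, ← setLIntegral_one]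
    refine setLIntegral_congr_fun hm fun y hy => ?_
    simp [hg1 y hy.2]
  have hsup : ∀ μ : RadonMeasure Y, μ.1 B = ⨆ n, μ.1 (B ∩ compactCovering Y n) := by
    intro μ
    rw [← Monotone.measure_iUnion, ← inter_iUnion, iUnion_compactCovering, inter_univ]
    exact fun i j hij => inter_subset_inter_right _ (compactCovering_subset _ hij)
  simp_rw [hsup]
  exact Measurable.iSup key

theorem radonMeasure_measurableSpace_eq_comap :
    (RadonMeasure.instMeasurableSpace : MeasurableSpace (RadonMeasure Y)) =
      MeasurableSpace.comap Subtype.val inferInstance :=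
  le_antisymm borel_radonMeasure_le measurable_radonMeasure_val.comap_le

end Vague

/-! ### S-finite kernels and the evaluation kernels -/

section Kernel

variable {α β : Type*} [MeasurableSpace α] [MeasurableSpace β]

/-- A kernel which is finite on the members of a countable measurable cover is s-finite. -/
theorem isSFiniteKernel_of_iUnion_eq_univ (κ : Kernel α β) (K : ℕ → Set β)
    (hK : ∀ n, MeasurableSet (K n)) (hU : ⋃ n, K n = univ) (hfin : ∀ a n, κ a (K n) < ∞) :
    IsSFiniteKernel κ := by
  classical
  have hD : ∀ n, MeasurableSet (disjointed K n) := fun n => MeasurableSet.disjointed hK n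
  have hfinD : ∀ a n, κ a (disjointed K n) ≠ ∞ := fun a n =>
    ((measure_mono (disjointed_subset K n)).trans_lt (hfin a n)).ne
  -- The masses of a piece are finite but need not be bounded uniformly in a. Splitting α by the
  -- integer part j of the mass leaves kernels bounded by j + 1.
  have hP : ∀ p : ℕ × ℕ, MeasurableSet {a | ⌊(κ a (disjointed K p.1)).toReal⌋₊ = p.2} := fun p =>
    (Nat.measurable_floor.comp (κ.measurable_coe (hD p.1)).ennreal_toReal)
      (measurableSet_singleton p.2)
  have hsum : κ = Kernel.sum fun p : ℕ × ℕ =>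
      Kernel.piecewise (hP p) (κ.restrict (hD p.1)) 0 := by
    ext a s hs
    rw [Kernel.sum_apply' _ _ hs, ENNReal.summable.tsum_prod' fun _ => ENNReal.summable]
    have hinner : ∀ n, ∑' j, Kernel.piecewise (hP (n, j)) (κ.restrict (hD n)) 0 a s =
        κ a (s ∩ disjointed K n) := by
      intro n
      rw [tsum_eq_single ⌊(κ a (disjointed K n)).toReal⌋₊]
      · rw [Kernel.piecewise_apply', if_pos (by simp), Kernel.restrict_apply' _ _ _ hs]
      · intro j hj
        rw [Kernel.piecewise_apply', if_neg (by simpa using hj.symm)]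
        simp
    simp_rw [hinner]
    rw [← measure_iUnion _ fun n => hs.inter (hD n), ← inter_iUnion, iUnion_disjointed, hU,
      inter_univ]
    exact fun i j hij => (disjoint_disjointed K hij).mono inter_subset_right inter_subset_right
  rw [hsum]
  have : ∀ p : ℕ × ℕ, IsFiniteKernel (Kernel.piecewise (hP p) (κ.restrict (hD p.1)) 0) := by
    intro p
    refine ⟨⟨p.2 + 1, by simp [ENNReal.add_lt_top], fun a => ?_⟩⟩
    rw [Kernel.piecewise_apply']
    split_ifs with h
    · rw [Kernel.restrict_apply' _ _ _ .univ, univ_inter, ← ENNReal.ofReal_toReal (hfinD a p.1)]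
      have h1 := (Nat.lt_floor_add_one (κ a (disjointed K p.1)).toReal).le
      rw [show ⌊(κ a (disjointed K p.1)).toReal⌋₊ = p.2 from h] at h1
      refine (ENNReal.ofReal_le_ofReal h1).trans ?_
      rw [ENNReal.ofReal_add (by positivity) zero_le_one]
      simp
    · simp
  infer_instance

/-- The mass of a point under an s-finite kernel is jointly measurable. -/
theorem measurable_kernel_singleton [MeasurableEq β] (κ : Kernel α β) [IsSFiniteKernel κ] :
    Measurable fun p : α × β => κ p.1 {p.2} := by
  have ht : MeasurableSet {q : (α × β) × β | q.2 = q.1.2} :=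
    measurableSet_eq_fun measurable_snd measurable_fst.snd
  exact Kernel.measurable_kernel_prodMk_left (κ := κ.comap Prod.fst measurable_fst) ht

end Kernel

section RadonKernel

variable {Y : Type*} [TopologicalSpace Y] [T2Space Y] [LocallyCompactSpace Y]
  [SecondCountableTopology Y] [MeasurableSpace Y] [BorelSpace Y]

variable (Y) in
/-- The evaluation kernel of Radon measures. -/
noncomputable def radonKernel : Kernel (RadonMeasure Y) Y where
  toFun μ := μ.1
  measurable' := measurable_radonMeasure_val

instance : IsSFiniteKernel (radonKernel Y) :=
  isSFiniteKernel_of_iUnion_eq_univ _ (compactCovering Y)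
    (fun n => (isCompact_compactCovering Y n).measurableSet) (iUnion_compactCovering Y)
    fun μ n => (isCompact_compactCovering Y n).measure_lt_top (μ := μ.1)

end RadonKernel

/-! ### The σ-algebras of the cone and of the configurations -/

section Spaces

variable {X : Type*} [TopologicalSpace X] [PolishSpace X] [LocallyCompactSpace X]
  [MeasurableSpace X] [BorelSpace X]

theorem cone_measurableSpace_eq_comap :
    (Cone.instMeasurableSpace : MeasurableSpace (Cone X)) =
      MeasurableSpace.comap Cone.toMeasure inferInstance := by
  refine borel_comap.trans ?_
  refine (congrArg _ (radonMeasure_measurableSpace_eq_comap (Y := X))).trans ?_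
  exact MeasurableSpace.comap_comp

theorem measurable_cone_toMeasure : Measurable (Cone.toMeasure : Cone X → Measure X) :=
  measurable_iff_comap_le.2 cone_measurableSpace_eq_comap.ge

/-- A map into the cone is measurable iff it is measurable as a map into measures. -/
theorem measurable_cone_iff {Ω : Type*} [MeasurableSpace Ω] {g : Ω → Cone X} :
    Measurable g ↔ Measurable fun ω => (g ω).toMeasure := by
  refine ⟨fun h => measurable_cone_toMeasure.comp h, fun h => ?_⟩
  rw [cone_measurableSpace_eq_comap]
  exact measurable_comap_iff.2 h

variable (X) in
/-- The evaluation kernel of the cone. -/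
noncomputable def coneKernel : Kernel (Cone X) X where
  toFun := Cone.toMeasure
  measurable' := measurable_cone_toMeasure

instance : IsSFiniteKernel (coneKernel X) := by
  have hm : Measurable fun η : Cone X => η.1 := continuous_induced_dom.borel_measurable
  exact inferInstanceAs (IsSFiniteKernel ((radonKernel X).comap _ hm))

theorem configuration_measurableSpace_eq_comap :
    (Configuration.instMeasurableSpace : MeasurableSpace (Configuration X)) =
      MeasurableSpace.comap Configuration.toMeasure inferInstance := by
  refine borel_comap.trans ?_
  refine (congrArg _ (radonMeasure_measurableSpace_eq_comap (Y := PosReal × X))).trans ?_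
  exact MeasurableSpace.comap_comp

theorem measurable_configuration_toMeasure :
    Measurable (Configuration.toMeasure : Configuration X → Measure (PosReal × X)) :=
  measurable_iff_comap_le.2 configuration_measurableSpace_eq_comap.ge

/-- A map into configurations is measurable iff it is measurable as a map into measures. -/
theorem measurable_configuration_iff {Ω : Type*} [MeasurableSpace Ω] {g : Ω → Configuration X} :
    Measurable g ↔ Measurable fun ω => (g ω).toMeasure := by
  refine ⟨fun h => measurable_configuration_toMeasure.comp h, fun h => ?_⟩
  rw [configuration_measurableSpace_eq_comap]
  exact measurable_comap_iff.2 h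

variable (X) in
/-- The evaluation kernel of configurations. -/
noncomputable def configurationKernel : Kernel (Configuration X) (PosReal × X) where
  toFun := Configuration.toMeasure
  measurable' := measurable_configuration_toMeasure

instance : IsSFiniteKernel (configurationKernel X) :=
  isSFiniteKernel_of_iUnion_eq_univ _ (compactCovering (PosReal × X))
    (fun n => (isCompact_compactCovering _ n).measurableSet) (iUnion_compactCovering _)
    fun γ n => γ.toRadon.2.lt_top_of_isCompact (isCompact_compactCovering _ n)

end Spaces

/-! ### Configurations as counting measures, and the insertion of a point -/

theorem IsBoundedBorel.inter {Y : Type*} [TopologicalSpace Y] [MeasurableSpace Y] {B C : Set Y}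
    (hB : IsBoundedBorel B) (hC : MeasurableSet C) : IsBoundedBorel (C ∩ B) :=
  ⟨hC.inter hB.1, hB.2.of_isClosed_subset isClosed_closure (closure_mono inter_subset_right)⟩

theorem isBoundedBorel_of_isCompact {Y : Type*} [TopologicalSpace Y] [T2Space Y]
    [MeasurableSpace Y] [BorelSpace Y] {K : Set Y} (hK : IsCompact K) : IsBoundedBorel K :=
  ⟨hK.measurableSet, by rwa [hK.isClosed.closure_eq]⟩

theorem IsBoundedBorel.measure_lt_top {Y : Type*} [TopologicalSpace Y] [MeasurableSpace Y]
    {B : Set Y} (hB : IsBoundedBorel B) (μ : Measure Y) [IsFiniteMeasureOnCompacts μ] :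
    μ B < ∞ :=
  (measure_mono subset_closure).trans_lt hB.2.measure_lt_top

namespace Configuration

variable {X : Type*} [TopologicalSpace X] [MeasurableSpace X]

theorem toMeasure_apply (γ : Configuration X) {B : Set (PosReal × X)} (hB : MeasurableSet B) :
    γ.toMeasure B = ((γ.1 ∩ B).encard : ℝ≥0∞) := by
  have h1 : γ.toMeasure B = Measure.count ((Subtype.val : γ.1 → PosReal × X) ⁻¹' B) := by
    rw [toMeasure, Measure.sum_apply _ hB, Measure.count,
      Measure.sum_apply _ (measurable_subtype_coe hB)]
    refine tsum_congr fun y => ?_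
    rw [Measure.dirac_apply' _ hB, Measure.dirac_apply' _ (measurable_subtype_coe hB)]
    rfl
  rw [h1, Measure.count_apply (measurable_subtype_coe hB), ← Subtype.val_injective.encard_image, Subtype.image_preimage_coe]

theorem lintegral_toMeasure (γ : Configuration X) {f : PosReal × X → ℝ≥0∞} (hf : Measurable f) :
    ∫⁻ p, f p ∂γ.toMeasure = ∑' p : γ.1, f p := by
  rw [toMeasure, lintegral_sum_measure]
  exact tsum_congr fun p => lintegral_dirac' _ hf

theorem toMeasure_singleton_eq_zero_iff [MeasurableSingletonClass X] (γ : Configuration X)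
    (p : PosReal × X) : γ.toMeasure {p} = 0 ↔ p ∉ γ.1 := by
  rw [γ.toMeasure_apply (measurableSet_singleton p)]
  simp

/-- The configuration `γ ∪ {p}`. -/
def insertPoint (γ : Configuration X) (p : PosReal × X) : Configuration X :=
  ⟨insert p γ.1, fun Λ hΛ a b hab =>
    ((γ.2 Λ hΛ a b hab).insert p).subset fun _ hq =>
      hq.1.imp id fun h => ⟨h, hq.2⟩⟩

theorem insertPoint_of_mem {γ : Configuration X} {p : PosReal × X} (hp : p ∈ γ.1) :
    γ.insertPoint p = γ :=
  Subtype.ext (insert_eq_of_mem hp)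

theorem toMeasure_insertPoint {γ : Configuration X} {p : PosReal × X} (hp : p ∉ γ.1) :
    (γ.insertPoint p).toMeasure = γ.toMeasure + Measure.dirac p := by
  ext B hB
  rw [Measure.add_apply, toMeasure_apply _ hB, toMeasure_apply _ hB, Measure.dirac_apply' _ hB]
  by_cases hpB : p ∈ B
  · rw [insertPoint, insert_inter_of_mem hpB, encard_insert_of_notMem fun h => hp h.1]
    simp [hpB]
  · rw [insertPoint, insert_inter_of_notMem hpB]
    simp [hpB]

variable [PolishSpace X] [BorelSpace X]

theorem finite_inter_of_isBoundedBorel (γ : Configuration X) {B : Set (PosReal × X)}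
    (hB : IsBoundedBorel B) : (γ.1 ∩ B).Finite :=
  (γ.finite_inter_compact hB.2).subset (inter_subset_inter_right _ subset_closure)

theorem toMeasure_eq_count (γ : Configuration X) {B : Set (PosReal × X)}
    (hB : IsBoundedBorel B) : γ.toMeasure B = γ.count B := by
  rw [γ.toMeasure_apply hB.1, count, ← (γ.finite_inter_of_isBoundedBorel hB).cast_ncard_eq]
  simp

theorem count_insertPoint {γ : Configuration X} {p : PosReal × X} (hp : p ∉ γ.1)
    {B : Set (PosReal × X)} (hB : IsBoundedBorel B) :
    (γ.insertPoint p).count B = γ.count B + B.indicator 1 p := by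
  have h := congrArg (fun μ : Measure (PosReal × X) => μ B) (toMeasure_insertPoint hp)
  simp only [Measure.add_apply, toMeasure_eq_count _ hB, Measure.dirac_apply' _ hB.1] at h
  by_cases hpB : p ∈ B
  · simp only [hpB, indicator_of_mem, Pi.one_apply] at h ⊢
    exact_mod_cast h
  · simp only [hpB, indicator_of_notMem, not_false_eq_true, add_zero] at h ⊢
    exact_mod_cast h

theorem measurable_count [LocallyCompactSpace X] {B : Set (PosReal × X)}
    (hB : IsBoundedBorel B) : Measurable fun γ : Configuration X => γ.count B := by
  refine measurable_to_countable' fun n => ?_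
  have h : (fun γ : Configuration X => γ.count B) ⁻¹' {n} =
      {γ | γ.toMeasure B = (n : ℝ≥0∞)} := by
    ext γ
    simp [toMeasure_eq_count _ hB]
  rw [h]
  exact ((Measure.measurable_coe hB.1).comp measurable_configuration_toMeasure)
    (measurableSet_singleton _)

theorem measurable_toMeasure_of_measurable_count [LocallyCompactSpace X] {Ω : Type*}
    [MeasurableSpace Ω] {g : Ω → Configuration X}
    (hg : ∀ B, IsBoundedBorel B → Measurable fun ω => (g ω).count B) :
    Measurable fun ω => (g ω).toMeasure := by
  refine Measure.measurable_of_measurable_coe _ fun C hC => ?_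
  have hK : ∀ n, IsBoundedBorel (C ∩ compactCovering (PosReal × X) n) := fun n =>
    (isBoundedBorel_of_isCompact (isCompact_compactCovering _ n)).inter hC
  have hsup : ∀ γ : Configuration X, γ.toMeasure C =
      ⨆ n, (γ.count (C ∩ compactCovering (PosReal × X) n) : ℝ≥0∞) := by
    intro γ
    simp_rw [← γ.toMeasure_eq_count (hK _)]
    rw [← Monotone.measure_iUnion, ← inter_iUnion, iUnion_compactCovering, inter_univ]
    exact fun i j hij => inter_subset_inter_right _ (compactCovering_subset _ hij)
  simp_rw [hsup]
  exact Measurable.iSup fun n =>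
    (measurable_of_countable (fun k : ℕ => (k : ℝ≥0∞))).comp (hg _ (hK n))

/-- The Borel sigma-algebra on configurations is generated by the numbers of points in bounded
Borel sets. -/
theorem measurableSpace_eq_comap_count [LocallyCompactSpace X] :
    (instMeasurableSpace : MeasurableSpace (Configuration X)) =
      MeasurableSpace.comap
        (fun γ (B : {B : Set (PosReal × X) // IsBoundedBorel B}) => γ.count B.1)
        MeasurableSpace.pi := by
  refine le_antisymm ?_ (measurable_iff_comap_le.1
    (measurable_pi_lambda _ fun B => measurable_count B.2))
  rw [configuration_measurableSpace_eq_comap]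
  refine @Measurable.comap_le _ _ (_) _ _
    (@measurable_toMeasure_of_measurable_count _ _ _ _ _ _ _ (_) id fun B hB => ?_)
  exact (measurable_pi_apply (X := fun _ : {B : Set (PosReal × X) // IsBoundedBorel B} => ℕ)
    ⟨B, hB⟩).comp
    (comap_measurable _)

theorem measurable_insertPoint [LocallyCompactSpace X] :
    Measurable fun q : Configuration X × (PosReal × X) => q.1.insertPoint q.2 := by
  classical
  rw [measurable_configuration_iff]
  have hE : MeasurableSet {q : Configuration X × (PosReal × X) | q.1.toMeasure {q.2} = 0} :=
    measurable_kernel_singleton (configurationKernel X) (measurableSet_singleton 0)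
  -- Inserting a point already present changes nothing, so the formula splits according to the
  -- jointly measurable condition γ({p}) = 0.
  have h : (fun q : Configuration X × (PosReal × X) => (q.1.insertPoint q.2).toMeasure) =
      fun q => if q.1.toMeasure {q.2} = 0 then q.1.toMeasure + Measure.dirac q.2
        else q.1.toMeasure := by
    ext1 q
    split_ifs with hq
    · exact toMeasure_insertPoint ((toMeasure_singleton_eq_zero_iff _ _).1 hq)
    · rw [insertPoint_of_mem (not_not.1 fun hn => hq ((toMeasure_singleton_eq_zero_iff _ _).2 hn))]
  rw [h]
  have hm : Measurable fun q : Configuration X × (PosReal × X) => q.1.toMeasure :=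
    measurable_configuration_toMeasure.comp measurable_fst
  have hd : Measurable fun q : Configuration X × (PosReal × X) => Measure.dirac q.2 :=
    Measure.measurable_dirac.comp measurable_snd
  refine Measurable.ite hE (Measure.measurable_of_measurable_coe _ fun B hB => ?_) hm
  simp only [Measure.add_apply]
  exact ((Measure.measurable_coe hB).comp hm).add ((Measure.measurable_coe hB).comp hd)

end Configuration

/-! ### The Mecke equation for independent Poisson variables -/

section Poisson

open scoped Nat in
theorem poissonMeasure_singleton_succ (r : ℝ≥0) (k : ℕ) :
    ((k + 1 : ℕ) : ℝ≥0∞) * poissonMeasure r {k + 1} = r * poissonMeasure r {k} := by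
  rw [poissonMeasure_singleton, poissonMeasure_singleton, ← ENNReal.ofReal_natCast,
    ← ENNReal.ofReal_coe_nnreal, ← ENNReal.ofReal_mul (by positivity),
    ← ENNReal.ofReal_mul (by positivity)]
  congr 1
  rw [Nat.factorial_succ]
  push_cast
  have h1 : (k ! : ℝ) ≠ 0 := by positivity
  have h2 : (k + 1 : ℝ) ≠ 0 := by positivity
  field_simp
  ring

/-- The Mecke equation for a finite family of independent Poisson variables. -/
theorem lintegral_mul_eq_of_iIndepFun_poisson {Ω J : Type*} [MeasurableSpace Ω] [Fintype J]
    [DecidableEq J] {μ : Measure Ω} [IsProbabilityMeasure μ] {N : J → Ω → ℕ}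
    (hNm : ∀ j, Measurable (N j)) {r : J → ℝ≥0}
    (hN : ∀ j, HasLaw (N j) (poissonMeasure (r j)) μ) (hind : iIndepFun N μ)
    (h : (J → ℕ) → ℝ≥0∞) (j : J) :
    ∫⁻ ω, h (fun i => N i ω) * N j ω ∂μ =
      r j * ∫⁻ ω, h ((fun i => N i ω) + Pi.single j 1) ∂μ := by
  have hm : Measurable fun ω i => N i ω := measurable_pi_lambda _ hNm
  have hlaw : μ.map (fun ω i => N i ω) = Measure.pi fun i => poissonMeasure (r i) := by
    rw [(iIndepFun_iff_map_fun_eq_pi_map fun i => (hNm i).aemeasurable).1 hind]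
    simp_rw [fun i => (hN i).map_eq]
  have hint : ∀ f : (J → ℕ) → ℝ≥0∞, ∫⁻ ω, f (fun i => N i ω) ∂μ =
      ∑' k, f k * ∏ i, poissonMeasure (r i) {k i} := by
    intro f
    rw [← lintegral_map (measurable_of_countable f) hm, hlaw, lintegral_countable']
    simp_rw [Measure.pi_singleton]
  rw [hint fun k => h k * k j, (hint fun k => h (k + Pi.single j 1) :), ← ENNReal.tsum_mul_left]
  -- The left sum is reindexed by raising the j-th coordinate by one; the indices missed have k j =
  -- 0, where the factor k j kills the term.
  have hinj : Function.Injective fun k : J → ℕ => k + Pi.single j 1 := fun k l hkl =>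
    add_right_cancel hkl
  rw [← hinj.tsum_eq]
  · refine tsum_congr fun k => ?_
    rw [← Finset.mul_prod_erase _ _ (Finset.mem_univ j),
      ← Finset.mul_prod_erase _ _ (Finset.mem_univ j)]
    have herase : ∏ i ∈ Finset.univ.erase j,
        poissonMeasure (r i) {(k + Pi.single j 1 : J → ℕ) i} =
        ∏ i ∈ Finset.univ.erase j, poissonMeasure (r i) {k i} :=
      Finset.prod_congr rfl fun i hi => by simp [Finset.ne_of_mem_erase hi]
    have hs := poissonMeasure_singleton_succ (r j) (k j)
    rw [herase]
    simp only [Pi.add_apply, Pi.single_eq_same]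
    calc _ = h (k + Pi.single j 1) * (((k j + 1 : ℕ) : ℝ≥0∞) * poissonMeasure (r j) {k j + 1}) *
          ∏ i ∈ Finset.univ.erase j, poissonMeasure (r i) {k i} := by ring
      _ = _ := by rw [hs]; ring
  · intro k hk
    have hkj : k j ≠ 0 := fun h0 => hk (by simp [h0])
    refine ⟨k - Pi.single j 1, ?_⟩
    ext i
    by_cases hi : i = j
    · subst hi
      simp
      omega
    · simp [hi]

end Poisson

/-! ### Atoms of finite families of sets -/

/-- The atoms of the algebra generated by finitely many sets, inside of their union. -/
def atomOf {Y O : Type*} (C : O → Set Y) (j : O → Bool) : Set Y :=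
  -- Intersecting with the union empties the atom of the constantly false `j`, which would otherwise
  -- be the complement of all the sets and in general unbounded.
  (⋂ o, {p | p ∈ C o ↔ j o = true}) ∩ ⋃ o, C o

section Atoms

variable {Y O : Type*} {C : O → Set Y}

theorem pairwise_disjoint_atomOf : Pairwise fun i j => Disjoint (atomOf C i) (atomOf C j) := by
  intro i j hij
  refine Set.disjoint_left.2 fun p hi hj => hij (funext fun o => ?_)
  have h1 := mem_iInter.1 hi.1 o
  have h2 := mem_iInter.1 hj.1 o
  exact Bool.eq_iff_iff.2 (h1.symm.trans h2)

theorem isBoundedBorel_atomOf [Fintype O] [TopologicalSpace Y] [MeasurableSpace Y]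
    (hC : ∀ o, IsBoundedBorel (C o)) (j : O → Bool) : IsBoundedBorel (atomOf C j) := by
  refine IsBoundedBorel.inter ⟨MeasurableSet.iUnion fun o => (hC o).1, ?_⟩
    (MeasurableSet.iInter fun o => ?_)
  · rw [closure_iUnion_of_finite]
    exact isCompact_iUnion fun o => (hC o).2
  · cases hj : j o
    · convert (hC o).1.compl using 1
      ext p
      simp
    · simpa using! (hC o).1

theorem biUnion_atomOf [Fintype O] [DecidableEq O] (o : O) :
    ⋃ j ∈ (Finset.univ.filter fun j : O → Bool => j o = true), atomOf C j = C o := by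
  classical
  ext p
  simp only [Finset.mem_filter, Finset.mem_univ, true_and, mem_iUnion, exists_prop]
  constructor
  · rintro ⟨j, hj, hp⟩
    exact (mem_iInter.1 hp.1 o).2 hj
  · intro hp
    exact ⟨fun i => decide (p ∈ C i), by simpa using hp, by simp,
      mem_iUnion.2 ⟨o, hp⟩⟩

end Atoms

/-! ### The Mecke equation for Poisson measures -/

section Mecke

variable {X : Type*} [TopologicalSpace X] [PolishSpace X] [MeasurableSpace X] [BorelSpace X]
  {m : Measure (PosReal × X)} {π : Measure (Configuration X)}

theorem IsPoissonMeasure.iIndepFun_fintype (hπ : IsPoissonMeasure m π) {J : Type*} [Fintype J]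
    {E : J → Set (PosReal × X)} (hE : ∀ j, IsBoundedBorel (E j))
    (hd : Pairwise fun i j => Disjoint (E i) (E j)) :
    iIndepFun (fun j (γ : Configuration X) => γ.count (E j)) π := by
  let e := Fintype.equivFin J
  have := (hπ.iIndepFun_count _ (fun i => E (e.symm i)) (fun i => hE _)
    fun i j hij => hd (e.symm.injective.ne hij)).precomp e.injective
  simpa using this

theorem Configuration.count_eq_sum_atomOf {O : Type*} [Fintype O] [DecidableEq O]
    {C : O → Set (PosReal × X)} (hC : ∀ o, IsBoundedBorel (C o)) (γ : Configuration X) (o : O) :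
    γ.count (C o) = ∑ j : O → Bool with j o = true, γ.count (atomOf C j) := by
  have h : γ.toMeasure (C o) = ∑ j : O → Bool with j o = true, γ.toMeasure (atomOf C j) := by
    rw [← measure_biUnion_finset (fun i _ j _ hij => pairwise_disjoint_atomOf hij)
      fun j _ => (isBoundedBorel_atomOf hC j).1, biUnion_atomOf]
  simp_rw [toMeasure_eq_count _ (hC o), toMeasure_eq_count _ (isBoundedBorel_atomOf hC _)] at h
  exact_mod_cast h

variable [LocallyCompactSpace X]

theorem Configuration.ae_notMem [NullSingletonClass m] (γ : Configuration X) :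
    ∀ᵐ p ∂m, p ∉ γ.1 :=
  measure_eq_zero_iff_ae_notMem.1 (γ.countable.measure_zero m)

/-- The Mecke equation for functions of the numbers of points in disjoint sets. -/
theorem IsPoissonMeasure.lintegral_count_mul [IsFiniteMeasureOnCompacts m] [NullSingletonClass m]
    (hπ : IsPoissonMeasure m π) {J : Type*} [Fintype J]
    {E : J → Set (PosReal × X)} (hE : ∀ j, IsBoundedBorel (E j))
    (hd : Pairwise fun i j => Disjoint (E i) (E j)) (h : (J → ℕ) → ℝ≥0∞) (j : J) :
    ∫⁻ γ, h (fun i => γ.count (E i)) * γ.toMeasure (E j) ∂π =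
      ∫⁻ γ, ∫⁻ p in E j, h (fun i => (γ.insertPoint p).count (E i)) ∂m ∂π := by
  classical
  have := hπ.isProbabilityMeasure
  simp_rw [Configuration.toMeasure_eq_count _ (hE j)]
  rw [lintegral_mul_eq_of_iIndepFun_poisson (fun i => Configuration.measurable_count (hE i))
    (fun i => hπ.hasLaw_count _ (hE i)) (hπ.iIndepFun_fintype hE hd) h j,
    ENNReal.coe_toNNReal ((hE j).measure_lt_top m).ne,
    ← lintegral_const_mul' _ _ ((hE j).measure_lt_top m).ne]
  refine lintegral_congr fun γ => ?_
  rw [mul_comm, ← setLIntegral_const]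
  refine setLIntegral_congr_fun_ae (hE j).1 ?_
  -- For almost every p the insertion adds a genuinely new point, which raises the count of `E j` by
  -- one and, by disjointness, no other.
  filter_upwards [γ.ae_notMem (m := m)] with p hp hpE
  congr 1
  ext i
  rw [Configuration.count_insertPoint hp (hE i)]
  by_cases hij : i = j
  · subst hij
    simp [hpE]
  · have hi : p ∉ E i := fun hi => Set.disjoint_left.1 (hd hij) hi hpE
    simp [hij, hi]

/-- The Mecke equation for functions of the numbers of points in finitely many sets. -/
theorem IsPoissonMeasure.lintegral_count_mul_of_finite [IsFiniteMeasureOnCompacts m]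
    [NullSingletonClass m] (hπ : IsPoissonMeasure m π) {O : Type*} [Fintype O]
    {C : O → Set (PosReal × X)} (hC : ∀ o, IsBoundedBorel (C o)) (h : (O → ℕ) → ℝ≥0∞) (o : O) :
    ∫⁻ γ, h (fun i => γ.count (C i)) * γ.toMeasure (C o) ∂π =
      ∫⁻ γ, ∫⁻ p in C o, h (fun i => (γ.insertPoint p).count (C i)) ∂m ∂π := by
  classical
  let k : ((O → Bool) → ℕ) → ℝ≥0∞ := fun n => h fun i => ∑ j : O → Bool with j i = true, n j
  have hk : ∀ γ : Configuration X, h (fun i => γ.count (C i)) =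
      k fun j => γ.count (atomOf C j) := fun γ =>
    congrArg h (funext fun i => γ.count_eq_sum_atomOf hC i)
  have hdis : (↑(Finset.univ.filter fun j : O → Bool => j o = true) : Set (O → Bool)).PairwiseDisjoint
      (atomOf C) := fun i _ j _ hij => pairwise_disjoint_atomOf hij
  have hmeas : ∀ j, MeasurableSet (atomOf C j) := fun j => (isBoundedBorel_atomOf hC j).1
  have hkm : Measurable k := measurable_of_countable k
  have hN : Measurable fun (γ : Configuration X) (j : O → Bool) => γ.count (atomOf C j) :=
    measurable_pi_lambda _ fun j => Configuration.measurable_count (isBoundedBorel_atomOf hC j)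
  simp_rw [hk, ← biUnion_atomOf (C := C) o]
  simp_rw [lintegral_biUnion_finset hdis (fun j _ => hmeas j),
    measure_biUnion_finset hdis fun j _ => hmeas j, Finset.mul_sum]
  have hf1 : ∀ j, Measurable fun γ : Configuration X =>
      k (fun j => γ.count (atomOf C j)) * γ.toMeasure (atomOf C j) := fun j =>
    (hkm.comp hN).mul ((Measure.measurable_coe (hmeas j)).comp measurable_configuration_toMeasure)
  rw [lintegral_finsetSum _ fun j _ => hf1 j]
  simp_rw [hπ.lintegral_count_mul (isBoundedBorel_atomOf hC) pairwise_disjoint_atomOf k]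
  refine (lintegral_finsetSum _ fun j _ => ?_).symm
  have hfin : IsFiniteMeasure (m.restrict (atomOf C j)) :=
    ⟨by simpa using (isBoundedBorel_atomOf hC j).measure_lt_top m⟩
  exact Measurable.lintegral_prod_right' (f := fun q : Configuration X × (PosReal × X) =>
    k fun j => (q.1.insertPoint q.2).count (atomOf C j))
    ((hkm.comp hN).comp Configuration.measurable_insertPoint)

/-- With B fixed and bounded the right-hand measure is finite, so it suffices to compare on events
depending on finitely many counts, which form a generating π-system. -/
theorem IsPoissonMeasure.withDensity_eq_map_insertPoint [IsFiniteMeasureOnCompacts m]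
    [NullSingletonClass m] (hπ : IsPoissonMeasure m π) {B : Set (PosReal × X)}
    (hB : IsBoundedBorel B) :
    π.withDensity (fun γ => γ.toMeasure B) =
      (π.prod (m.restrict B)).map fun q => q.1.insertPoint q.2 := by
  classical
  have := hπ.isProbabilityMeasure
  have hfin : IsFiniteMeasure (m.restrict B) := ⟨by simpa using hB.measure_lt_top m⟩
  let N : Configuration X → {B : Set (PosReal × X) // IsBoundedBorel B} → ℕ :=
    fun γ B => γ.count B.1
  have hN : Measurable N := measurable_pi_lambda _ fun B => Configuration.measurable_count B.2
  have key : ∀ A ∈ preimage N '' measurableCylinders fun _ => ℕ,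
      ((π.prod (m.restrict B)).map fun q => q.1.insertPoint q.2) A =
        π.withDensity (fun γ => γ.toMeasure B) A := by
    rintro _ ⟨T, hT, rfl⟩
    have hTm : MeasurableSet (N ⁻¹' T) := hN (MeasurableSet.of_mem_measurableCylinders hT)
    obtain ⟨s, S, hS, rfl⟩ := (mem_measurableCylinders T).1 hT
    -- The index `none` carries B, so that B joins the finitely many sets that determine the event.
    let C : Option s → Set (PosReal × X) := fun o => o.elim B fun i => i.1.1
    have hC : ∀ o, IsBoundedBorel (C o) := by
      rintro (_ | i)
      exacts [hB, i.1.2]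
    let h : (Option s → ℕ) → ℝ≥0∞ := fun n => S.indicator 1 fun i => n (some i)
    have hh : ∀ γ : Configuration X, (N ⁻¹' cylinder s S).indicator 1 γ =
        h fun i => γ.count (C i) := fun γ => rfl
    have hmain := hπ.lintegral_count_mul_of_finite hC h none
    simp_rw [← hh] at hmain
    rw [Measure.map_apply Configuration.measurable_insertPoint hTm,
      Measure.prod_apply (Configuration.measurable_insertPoint hTm), withDensity_apply _ hTm,
      ← lintegral_indicator hTm]
    refine Eq.trans ?_ (hmain.symm.trans (lintegral_congr fun γ => ?_))
    · refine lintegral_congr fun γ => ?_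
      rw [← lintegral_indicator_one (measurable_prodMk_left
        (Configuration.measurable_insertPoint hTm))]
      rfl
    · by_cases hγ : γ ∈ N ⁻¹' cylinder s S
      · rw [indicator_of_mem hγ, indicator_of_mem hγ, Pi.one_apply, one_mul]
        rfl
      · rw [indicator_of_notMem hγ, indicator_of_notMem hγ, zero_mul]
  have huniv : (univ : Set (Configuration X)) ∈ preimage N '' measurableCylinders fun _ => ℕ :=
    ⟨univ, univ_mem_measurableCylinders _, preimage_univ⟩
  refine (ext_of_generate_finite _ ?_ (isPiSystem_measurableCylinders.comap N) key
    (key _ huniv)).symm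
  rw [Configuration.measurableSpace_eq_comap_count, ← generateFrom_measurableCylinders,
    MeasurableSpace.comap_generateFrom]
  rfl

/-- This is the Mecke equation as an equality of measures, the left one being the Campbell measure.
Both are finite over each compact piece of (0, ∞) × X, where agreement on rectangles suffices. -/
theorem IsPoissonMeasure.compProd_eq_map_insertPoint [IsFiniteMeasureOnCompacts m]
    [NullSingletonClass m] [SFinite m] (hπ : IsPoissonMeasure m π) :
    π ⊗ₘ configurationKernel X = (π.prod m).map fun q => (q.1.insertPoint q.2, q.2) := by
  have := hπ.isProbabilityMeasure
  have hins : Measurable fun q : Configuration X × (PosReal × X) => (q.1.insertPoint q.2, q.2) :=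
    Configuration.measurable_insertPoint.prodMk measurable_snd
  have key : ∀ A : Set (Configuration X), MeasurableSet A → ∀ B : Set (PosReal × X),
      IsBoundedBorel B → (π ⊗ₘ configurationKernel X) (A ×ˢ B) =
        ((π.prod m).map fun q => (q.1.insertPoint q.2, q.2)) (A ×ˢ B) := by
    intro A hA B hB
    have h := congrArg (fun μ : Measure _ => μ A) (hπ.withDensity_eq_map_insertPoint hB)
    simp only [withDensity_apply _ hA,
      Measure.map_apply Configuration.measurable_insertPoint hA] at h
    rw [Measure.compProd_apply_prod hA hB.1, Measure.map_apply hins (hA.prod hB.1)]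
    refine h.trans ?_
    nth_rw 1 [← Measure.restrict_univ (μ := π)]
    rw [Measure.prod_restrict, Measure.restrict_apply (Configuration.measurable_insertPoint hA)]
    congr 1
    ext q
    simp
  let K := compactCovering (PosReal × X)
  have hK : ∀ n, IsBoundedBorel (K n) := fun n =>
    isBoundedBorel_of_isCompact (isCompact_compactCovering _ n)
  have hU : ⋃ n, (univ : Set (Configuration X)) ×ˢ K n = univ := by
    rw [← prod_iUnion, iUnion_compactCovering, univ_prod_univ]
  refine (Measure.ext_iff_of_iUnion_eq_univ hU).2 fun n => ?_
  have hfin : IsFiniteMeasure ((π ⊗ₘ configurationKernel X).restrict (univ ×ˢ K n)) := by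
    refine ⟨?_⟩
    rw [Measure.restrict_apply_univ, key _ .univ _ (hK n),
      Measure.map_apply hins (MeasurableSet.univ.prod (hK n).1)]
    have : (fun q : Configuration X × (PosReal × X) => (q.1.insertPoint q.2, q.2)) ⁻¹'
        (univ ×ˢ K n) = univ ×ˢ K n := by
      ext q
      simp
    rw [this, Measure.prod_prod, measure_univ, one_mul]
    exact (hK n).measure_lt_top m
  refine Measure.ext_prod fun {A B} hA hB => ?_
  rw [Measure.restrict_apply (hA.prod hB), Measure.restrict_apply (hA.prod hB), prod_inter_prod,
    inter_univ]
  exact key A hA _ ((hK n).inter hB)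

/-- The **Mecke equation** for Poisson measures on configurations. -/
theorem IsPoissonMeasure.lintegral_lintegral_toMeasure [IsFiniteMeasureOnCompacts m]
    [NullSingletonClass m] [SFinite m] (hπ : IsPoissonMeasure m π)
    {G : Configuration X × (PosReal × X) → ℝ≥0∞} (hG : Measurable G) :
    ∫⁻ γ, ∫⁻ p, G (γ, p) ∂γ.toMeasure ∂π = ∫⁻ γ, ∫⁻ p, G (γ.insertPoint p, p) ∂m ∂π := by
  have := hπ.isProbabilityMeasure
  have hins : Measurable fun q : Configuration X × (PosReal × X) => (q.1.insertPoint q.2, q.2) :=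
    Configuration.measurable_insertPoint.prodMk measurable_snd
  have h := Measure.lintegral_compProd (μ := π) (κ := configurationKernel X) hG
  rw [hπ.compProd_eq_map_insertPoint, lintegral_map hG hins,
    lintegral_prod (fun q : Configuration X × (PosReal × X) => G (q.1.insertPoint q.2, q.2)) (hG.comp hins).aemeasurable] at h
  exact h.symm

end Mecke

theorem Configuration.isPinpointing_insertPoint {X : Type*} [TopologicalSpace X]
    [MeasurableSpace X] {γ : Configuration X} (hγ : γ.IsPinpointing)
    {p : PosReal × X} (hp : p.2 ∉ Prod.snd '' γ.1) : (γ.insertPoint p).IsPinpointing := by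
  rintro q (rfl | hq) r (rfl | hr) h
  · rfl
  · exact absurd ⟨r, hr, h.symm⟩ hp
  · exact absurd ⟨q, hq, h⟩ hp
  · exact hγ q hq r hr h

theorem Cone.toMeasure_addAtom {X : Type*} [TopologicalSpace X] [MeasurableSpace X]
    [MeasurableSingletonClass X] (η : Cone X) (s : PosReal) (x : X) :
    (η.addAtom s x).toMeasure = η.toMeasure + ENNReal.ofReal (s : ℝ) • Measure.dirac x :=
  rfl

theorem measurable_mul_indicator {X : Type*} [MeasurableSpace X] {Λ : Set X} (hΛ : MeasurableSet Λ) :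
    Measurable fun p : PosReal × X => ENNReal.ofReal (p.1 : ℝ) * Λ.indicator 1 p.2 :=
  (ENNReal.measurable_ofReal.comp (measurable_subtype_coe.comp measurable_fst)).mul
    ((measurable_one.indicator hΛ).comp measurable_snd)

/-! ### Measurability of the pinpointing condition -/

section Fibers

variable {X : Type*} [TopologicalSpace X] [PolishSpace X] [MeasurableSpace X] [BorelSpace X]

theorem Configuration.isPinpointing_iff (γ : Configuration X) :
    γ.IsPinpointing ↔ ∀ p ∈ γ.1, γ.toMeasure (Prod.snd ⁻¹' {p.2}) ≤ 1 := by
  have h : ∀ x : X, γ.toMeasure (Prod.snd ⁻¹' {x}) ≤ 1 ↔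
      ∀ p ∈ γ.1, ∀ q ∈ γ.1, p.2 = x → q.2 = x → p = q := by
    intro x
    rw [γ.toMeasure_apply (measurable_snd (measurableSet_singleton x)), ← ENat.toENNReal_one,
      ENat.toENNReal_le, encard_le_one_iff]
    simp only [mem_inter_iff, mem_preimage, mem_singleton_iff]
    exact ⟨fun h p hp q hq hpx hqx => h p q ⟨hp, hpx⟩ ⟨hq, hqx⟩,
      fun h p q hp hq => h p hp.1 q hq.1 hp.2 hq.2⟩
  simp_rw [h]
  refine ⟨fun H r _ p hp q hq hpr hqr => Prod.ext (H p hp q hq (hpr.trans hqr.symm))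
    (hpr.trans hqr.symm), fun H p hp q hq hpq => ?_⟩
  exact congrArg Prod.fst (H q hq p hp q hq hpq rfl)

/-- The indicator of the points which share their second coordinate with another point. -/
noncomputable def collisionIndicator (q : Configuration X × (PosReal × X)) : ℝ≥0∞ :=
  {q : Configuration X × (PosReal × X) | 1 < q.1.toMeasure (Prod.snd ⁻¹' {q.2.2})}.indicator 1 q

theorem collisionIndicator_insertPoint {γ : Configuration X} {p : PosReal × X}
    (hp : p.2 ∉ Prod.snd '' γ.1) : collisionIndicator (γ.insertPoint p, p) = 0 := by
  refine indicator_of_notMem ?_ _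
  rw [mem_ofPred_eq, not_lt]
  have hm : MeasurableSet (Prod.snd ⁻¹' {p.2} : Set (PosReal × X)) :=
    measurable_snd (measurableSet_singleton p.2)
  rw [Configuration.toMeasure_apply _ hm,
    ← ENat.toENNReal_one, ENat.toENNReal_le, encard_le_one_iff]
  have : ∀ q, q ∈ (γ.insertPoint p).1 ∩ Prod.snd ⁻¹' {p.2} → q = p := by
    rintro q ⟨rfl | hq, hqp⟩
    · rfl
    · exact absurd ⟨q, hq, hqp⟩ hp
  exact fun q r hq hr => (this q hq).trans (this r hr).symm

variable [LocallyCompactSpace X]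

theorem measurable_collisionIndicator :
    Measurable (collisionIndicator : Configuration X × (PosReal × X) → ℝ≥0∞) := by
  refine measurable_one.indicator (measurableSet_lt measurable_const ?_)
  have hq : Measurable fun q : Configuration X × (PosReal × X) => (q.1, q.2.2) := by fun_prop
  have h := (measurable_kernel_singleton ((configurationKernel X).map Prod.snd)).comp hq
  convert h using 1
  ext q
  exact (Kernel.map_apply' (configurationKernel X) measurable_snd q.1
    (measurableSet_singleton q.2.2)).symm

/-- Written as the vanishing of a sum over γ, the condition is measurable in γ and its expectation
is accessible to the Mecke equation. -/
theorem Configuration.isPinpointing_iff_lintegral (γ : Configuration X) :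
    γ.IsPinpointing ↔ ∫⁻ p, collisionIndicator (γ, p) ∂γ.toMeasure = 0 := by
  rw [γ.lintegral_toMeasure (f := fun p => collisionIndicator (γ, p))
      (measurable_collisionIndicator.comp measurable_prodMk_left),
    ENNReal.tsum_eq_zero, γ.isPinpointing_iff]
  simp [collisionIndicator]

end Fibers

/-! ### Local masses and the set of admissible configurations -/

section LocalMass

variable {X : Type*} [TopologicalSpace X] [MeasurableSpace X]

theorem Configuration.lintegral_toConeMeasure (γ : Configuration X) {g : X → ℝ≥0∞}
    (hg : Measurable g) :
    ∫⁻ x, g x ∂γ.toConeMeasure = ∑' p : γ.1, ENNReal.ofReal (p.1.1 : ℝ) * g p.1.2 := by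
  rw [toConeMeasure, lintegral_sum_measure]
  refine tsum_congr fun p => ?_
  rw [lintegral_smul_measure, lintegral_dirac' _ hg, smul_eq_mul]

theorem Configuration.IsPinpointing.toConeMeasure_singleton [MeasurableSingletonClass X]
    {γ : Configuration X} (hγ : γ.IsPinpointing) {p : PosReal × X} (hp : p ∈ γ.1) :
    γ.toConeMeasure {p.2} = ENNReal.ofReal (p.1 : ℝ) := by
  have hx := measurableSet_singleton p.2
  rw [γ.toConeMeasure_apply hx, localMass, lintegral_toMeasure _ (measurable_mul_indicator hx),
    tsum_eq_single (⟨p, hp⟩ : γ.1)]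
  · simp
  · intro q hq
    have : q.1.2 ≠ p.2 := fun h => hq (Subtype.ext (Prod.ext (hγ _ q.2 _ hp h) h))
    simp [this]

theorem Configuration.toConeMeasure_insertPoint {γ : Configuration X} {p : PosReal × X}
    [MeasurableSingletonClass X] (hp : p ∉ γ.1) : (γ.insertPoint p).toConeMeasure =
      γ.toConeMeasure + ENNReal.ofReal (p.1 : ℝ) • Measure.dirac p.2 := by
  ext A hA
  rw [toConeMeasure_apply _ hA, localMass, toMeasure_insertPoint hp, lintegral_add_measure,
    lintegral_dirac' _ (measurable_mul_indicator hA), Measure.add_apply, toConeMeasure_apply _ hA,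
    Measure.smul_apply, Measure.dirac_apply' _ hA]
  rfl

/-- Every bounded set lies in some member of the exhaustion; this reduces the condition on local
masses to countably many. -/
theorem mem_pinpointingFinite_iff [T2Space X] [BorelSpace X] (E : CompactExhaustion X)
    (γ : Configuration X) :
    γ ∈ pinpointingFinite X ↔ γ.IsPinpointing ∧ ∀ n, γ.localMass (E n) < ∞ := by
  refine and_congr_right fun _ => ⟨fun h n => h _ (isBoundedBorel_of_isCompact (E.isCompact n)),
    fun h Λ hΛ => ?_⟩
  obtain ⟨n, hn⟩ := E.exists_superset_of_isCompact hΛ.2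
  refine lt_of_le_of_lt ?_ (h n)
  rw [← γ.toConeMeasure_apply hΛ.1, ← γ.toConeMeasure_apply (E.isCompact n).measurableSet]
  exact measure_mono (subset_closure.trans hn)

variable [PolishSpace X] [BorelSpace X] [LocallyCompactSpace X]

theorem measurable_localMass {Λ : Set X} (hΛ : MeasurableSet Λ) :
    Measurable fun γ : Configuration X => γ.localMass Λ :=
  (Measure.measurable_lintegral (measurable_mul_indicator hΛ)).comp
    measurable_configuration_toMeasure

theorem measurable_toConeMeasure :
    Measurable (Configuration.toConeMeasure : Configuration X → Measure X) := by
  refine Measure.measurable_of_measurable_coe _ fun A hA => ?_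
  simp_rw [fun γ : Configuration X => γ.toConeMeasure_apply hA]
  exact measurable_localMass hA

theorem measurableSet_pinpointingFinite : MeasurableSet (pinpointingFinite X) := by
  have h : pinpointingFinite X =
      {γ | ∫⁻ p, collisionIndicator (γ, p) ∂γ.toMeasure = 0} ∩
        ⋂ n, {γ | γ.localMass (CompactExhaustion.choice X n) < ∞} := by
    ext γ
    rw [mem_pinpointingFinite_iff (CompactExhaustion.choice X), γ.isPinpointing_iff_lintegral]
    simp
  rw [h]
  refine MeasurableSet.inter ?_ (MeasurableSet.iInter fun n => ?_)
  · exact (measurable_collisionIndicator.lintegral_kernel_prod_right' (κ := configurationKernel X))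
      (measurableSet_singleton 0)
  · exact measurableSet_lt (measurable_localMass
      ((CompactExhaustion.choice X).isCompact n).measurableSet) measurable_const

end LocalMass

/-! ### The push-forward to the cone -/

section PushForward

variable {X : Type*} [TopologicalSpace X] [PolishSpace X] [LocallyCompactSpace X]
  [MeasurableSpace X] [BorelSpace X]

instance : Inhabited (Cone X) :=
  ⟨⟨⟨0, ⟨fun K _ => by simp⟩⟩,
    isDiscrete_of_countable (T := ∅) countable_empty (by simp) (by simp)⟩⟩

open Classical in
/-- An extension of `toCone` to all configurations. -/
noncomputable def toConeExtended (γ : Configuration X) : Cone X :=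
  if h : γ ∈ pinpointingFinite X then toCone ⟨γ, h⟩ else default

theorem toConeExtended_of_mem {γ : Configuration X} (h : γ ∈ pinpointingFinite X) :
    toConeExtended γ = toCone ⟨γ, h⟩ :=
  dif_pos h

theorem toMeasure_toConeExtended {γ : Configuration X} (h : γ ∈ pinpointingFinite X) :
    (toConeExtended γ).toMeasure = γ.toConeMeasure := by
  rw [toConeExtended_of_mem h]
  rfl

theorem measurable_toConeExtended :
    Measurable (toConeExtended : Configuration X → Cone X) := by
  classical
  rw [measurable_cone_iff]
  have h : (fun γ : Configuration X => (toConeExtended γ).toMeasure) = fun γ =>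
      if γ ∈ pinpointingFinite X then γ.toConeMeasure else (default : Cone X).toMeasure := by
    ext1 γ
    split_ifs with hγ
    · exact toMeasure_toConeExtended hγ
    · rw [toConeExtended, dif_neg hγ]
  rw [h]
  exact Measurable.ite measurableSet_pinpointingFinite measurable_toConeMeasure measurable_const

/-- The default value of `toConeExtended` is attained only on a null set, so the restriction to the
subtype can be dropped. -/
theorem coneLaw_eq_map {π : Measure (Configuration X)} (h : ∀ᵐ γ ∂π, γ ∈ pinpointingFinite X) :
    coneLaw π = π.map toConeExtended := by
  have h1 : (toCone : pinpointingFinite X → Cone X) = toConeExtended ∘ Subtype.val :=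
    funext fun γ => (toConeExtended_of_mem γ.2).symm
  rw [coneLaw, h1, ← Measure.map_map measurable_toConeExtended measurable_subtype_coe,
    map_comap_subtype_coe measurableSet_pinpointingFinite, Measure.restrict_eq_self_of_ae_mem h]

theorem Cone.measurable_addAtom :
    Measurable fun q : Cone X × (PosReal × X) => q.1.addAtom q.2.1 q.2.2 := by
  rw [measurable_cone_iff]
  simp_rw [Cone.toMeasure_addAtom]
  refine Measure.measurable_of_measurable_coe _ fun A hA => ?_
  simp only [Measure.add_apply, Measure.smul_apply, smul_eq_mul, Measure.dirac_apply' _ hA]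
  exact (((Measure.measurable_coe hA).comp measurable_cone_toMeasure).comp measurable_fst).add
    ((measurable_mul_indicator hA).comp measurable_snd)

theorem Cone.measurable_weight : Measurable fun q : Cone X × X => q.1.weight q.2 :=
  (measurable_kernel_singleton (coneKernel X)).ennreal_toReal

/-- The new location must differ from all old ones: otherwise the enlarged configuration could fail
to be pinpointing and `toConeExtended` would give the default. -/
theorem toConeExtended_insertPoint {γ : Configuration X} (hγ : γ ∈ pinpointingFinite X)
    {p : PosReal × X} (hp : p.2 ∉ Prod.snd '' γ.1) :
    toConeExtended (γ.insertPoint p) = (toConeExtended γ).addAtom p.1 p.2 := by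
  have hpγ : p ∉ γ.1 := fun h => hp ⟨p, h, rfl⟩
  have hmem : γ.insertPoint p ∈ pinpointingFinite X := by
    refine ⟨Configuration.isPinpointing_insertPoint hγ.1 hp, fun Λ hΛ => ?_⟩
    rw [← Configuration.toConeMeasure_apply _ hΛ.1, Configuration.toConeMeasure_insertPoint hpγ,
      Measure.add_apply, γ.toConeMeasure_apply hΛ.1]
    exact ENNReal.add_lt_top.2 ⟨hγ.2 Λ hΛ,
      ENNReal.mul_lt_top ENNReal.ofReal_lt_top (measure_lt_top _ _)⟩
  refine Subtype.ext (Subtype.ext ?_)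
  refine (toMeasure_toConeExtended hmem).trans ?_
  rw [Configuration.toConeMeasure_insertPoint hpγ, ← toMeasure_toConeExtended hγ]
  rfl

end PushForward

/-! ### Concentration on admissible configurations and transfer to the cone -/

section Main

variable {X : Type*} [TopologicalSpace X] [PolishSpace X] [LocallyCompactSpace X]
  [MeasurableSpace X] [BorelSpace X] {ν : Measure PosReal} {σ : Measure X}

theorem Configuration.ae_snd_notMem [SFinite ν] [SFinite σ] [NullSingletonClass σ]
    (γ : Configuration X) : ∀ᵐ p ∂ν.prod σ, p.2 ∉ Prod.snd '' γ.1 := by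
  refine measure_eq_zero_iff_ae_notMem.1
    (?_ : ν.prod σ (Prod.snd ⁻¹' (Prod.snd '' γ.1)) = 0)
  rw [← univ_prod, Measure.prod_prod, (γ.countable.image _).measure_zero σ, mul_zero]

/-- A Poisson measure is concentrated on pinpointing configurations with finite local mass. -/
theorem IsPoissonMeasure.ae_mem_pinpointingFinite [IsFiniteMeasureOnCompacts ν]
    [NullSingletonClass ν] (hν : ∫⁻ s : PosReal, ENNReal.ofReal (s : ℝ) ∂ν < ∞)
    [IsFiniteMeasureOnCompacts σ] [NullSingletonClass σ]
    {π : Measure (Configuration X)} (hπ : IsPoissonMeasure (ν.prod σ) π) :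
    ∀ᵐ γ ∂π, γ ∈ pinpointingFinite X := by
  have hpin : ∀ᵐ γ ∂π, γ.IsPinpointing := by
    -- By the Mecke equation the expected number of colliding points is an integral over inserted
    -- points, and almost no inserted point collides.
    have h0 : ∫⁻ γ, ∫⁻ p, collisionIndicator (γ, p) ∂γ.toMeasure ∂π = 0 := by
      rw [hπ.lintegral_lintegral_toMeasure measurable_collisionIndicator]
      refine (lintegral_congr fun γ => ?_).trans lintegral_zero
      rw [lintegral_congr_ae (g := 0), Pi.zero_def, lintegral_zero]
      filter_upwards [γ.ae_snd_notMem (ν := ν) (σ := σ)] with p hp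
      exact collisionIndicator_insertPoint hp
    have h1 := (lintegral_eq_zero_iff (measurable_collisionIndicator.lintegral_kernel_prod_right'
      (κ := configurationKernel X))).1 h0
    filter_upwards [h1] with γ hγ
    exact γ.isPinpointing_iff_lintegral.2 hγ
  have hmass : ∀ n, ∀ᵐ γ ∂π, γ.localMass (CompactExhaustion.choice X n) < ∞ := by
    intro n
    have hK := (CompactExhaustion.choice X).isCompact n
    refine ae_lt_top (measurable_localMass hK.measurableSet) (ne_of_lt ?_)
    have := hπ.isProbabilityMeasure
    -- For s 1_K(x) the Mecke equation gives the mean local mass ∫ s dν(s) · σ(K), which is finite.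
    have h := hπ.lintegral_lintegral_toMeasure
      ((measurable_mul_indicator hK.measurableSet).comp measurable_snd)
    simp only [Function.comp] at h
    refine h.trans_lt ?_
    rw [lintegral_const, measure_univ, mul_one, lintegral_prod_mul
      (f := fun s : PosReal => ENNReal.ofReal (s : ℝ))
      (ENNReal.measurable_ofReal.comp measurable_subtype_coe).aemeasurable
      (measurable_one.indicator hK.measurableSet).aemeasurable,
      lintegral_indicator_one hK.measurableSet]
    exact ENNReal.mul_lt_top hν hK.measure_lt_top
  filter_upwards [hpin, ae_all_iff.2 hmass] with γ h1 h2
  exact (mem_pinpointingFinite_iff (CompactExhaustion.choice X) γ).2 ⟨h1, h2⟩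

/-- The function `(η, x) ↦ F (η, s_x(η), x)`, extended by zero to `s_x(η) = 0`. -/
noncomputable def atomFunction (F : Cone X × (PosReal × X) → ℝ≥0∞) (q : Cone X × X) : ℝ≥0∞ :=
  if h : 0 < q.1.weight q.2 then F (q.1, (⟨q.1.weight q.2, h⟩, q.2)) else 0

theorem measurable_atomFunction {F : Cone X × (PosReal × X) → ℝ≥0∞} (hF : Measurable F) :
    Measurable (atomFunction F) := by
  classical
  have hs : MeasurableSet {q : Cone X × X | 0 < q.1.weight q.2} :=
    measurableSet_lt measurable_const Cone.measurable_weight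
  have hf : Measurable fun q : {q : Cone X × X | 0 < q.1.weight q.2} =>
      F (q.1.1, (⟨q.1.1.weight q.1.2, q.2⟩, q.1.2)) :=
    hF.comp ((measurable_fst.comp measurable_subtype_coe).prodMk
      ((Cone.measurable_weight.comp measurable_subtype_coe).subtype_mk.prodMk
        (measurable_snd.comp measurable_subtype_coe)))
  convert Measurable.dite hf (g := fun _ => 0) measurable_const hs using 1
  ext q
  simp only [atomFunction, mem_ofPred_eq]

/-- Pinpointing guarantees that the weight at x is exactly the s of the single point (s, x) ∈ γ, so
both sides are the same sum over γ. -/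
theorem lintegral_atomFunction_toConeExtended {F : Cone X × (PosReal × X) → ℝ≥0∞}
    (hF : Measurable F) {γ : Configuration X} (hγ : γ ∈ pinpointingFinite X) :
    ∫⁻ x, atomFunction F (toConeExtended γ, x) ∂(toConeExtended γ).toMeasure =
      ∫⁻ p, ENNReal.ofReal (p.1 : ℝ) * F (toConeExtended γ, p) ∂γ.toMeasure := by
  have hs : Measurable fun p : PosReal × X => ENNReal.ofReal (p.1 : ℝ) :=
    ENNReal.measurable_ofReal.comp (measurable_subtype_coe.comp measurable_fst)
  rw [γ.lintegral_toMeasure (f := fun p => ENNReal.ofReal (p.1 : ℝ) * F (toConeExtended γ, p))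
      (hs.mul (hF.comp measurable_prodMk_left)),
    toMeasure_toConeExtended hγ, γ.lintegral_toConeMeasure
      (g := fun x => atomFunction F (toConeExtended γ, x)) ((measurable_atomFunction hF).comp measurable_prodMk_left)]
  refine tsum_congr fun p => ?_
  have hw : (toConeExtended γ).weight p.1.2 = p.1.1 := by
    rw [Cone.weight, toMeasure_toConeExtended hγ, hγ.1.toConeMeasure_singleton p.2,
      ENNReal.toReal_ofReal (le_of_lt p.1.1.2)]
  have hpos : 0 < (toConeExtended γ).weight p.1.2 := hw ▸ p.1.1.2
  have he : (⟨_, hpos⟩ : PosReal) = p.1.1 := Subtype.ext hw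
  rw [atomFunction, dif_pos hpos, he]

end Main

end DiscreteRadon

/-! ### The Mecke identity on the cone -/

open DiscreteRadon
theorem mainTheorem7 {X : Type*} [TopologicalSpace X] [PolishSpace X] [LocallyCompactSpace X]
    [MeasurableSpace X] [BorelSpace X]
    (ν : Measure PosReal) [IsFiniteMeasureOnCompacts ν] [NullSingletonClass ν]
    (hν : ∫⁻ s : PosReal, ENNReal.ofReal (s : ℝ) ∂ν < ∞)
    (σ : Measure X) [IsFiniteMeasureOnCompacts σ] [NullSingletonClass σ]
    (π : Measure (Configuration X)) (hπ : IsPoissonMeasure (ν.prod σ) π)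
    (F : Cone X × (PosReal × X) → ℝ≥0∞) (hF : Measurable F) :
    ∫⁻ η : Cone X, ∫⁻ x : X,
        (if h : 0 < η.weight x then F (η, (⟨η.weight x, h⟩, x)) else 0)
        ∂η.toMeasure ∂(coneLaw π) =
      ∫⁻ η : Cone X, ∫⁻ x : X, ∫⁻ s : PosReal,
        ENNReal.ofReal (s : ℝ) * F (η.addAtom s x, (s, x)) ∂ν ∂σ ∂(coneLaw π) := by
  have hmem := hπ.ae_mem_pinpointingFinite hν
  have hs : Measurable fun p : PosReal × X => ENNReal.ofReal (p.1 : ℝ) :=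
    ENNReal.measurable_ofReal.comp (measurable_subtype_coe.comp measurable_fst)
  have hG : Measurable fun q : Configuration X × (PosReal × X) =>
      ENNReal.ofReal (q.2.1 : ℝ) * F (toConeExtended q.1, q.2) :=
    (hs.comp measurable_snd).mul
      (hF.comp ((measurable_toConeExtended.comp measurable_fst).prodMk measurable_snd))
  have hR : Measurable fun q : Cone X × (PosReal × X) =>
      ENNReal.ofReal (q.2.1 : ℝ) * F (q.1.addAtom q.2.1 q.2.2, q.2) :=
    (hs.comp measurable_snd).mul (hF.comp (Cone.measurable_addAtom.prodMk measurable_snd))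
  have hswap : ∀ η : Cone X, ∫⁻ x, ∫⁻ s, ENNReal.ofReal (s : ℝ) * F (η.addAtom s x, (s, x)) ∂ν ∂σ =
      ∫⁻ p, ENNReal.ofReal (p.1 : ℝ) * F (η.addAtom p.1 p.2, p) ∂ν.prod σ := fun η =>
    (lintegral_prod_symm (fun p : PosReal × X =>
      ENNReal.ofReal (p.1 : ℝ) * F (η.addAtom p.1 p.2, p))
      (hR.comp measurable_prodMk_left).aemeasurable).symm
  simp_rw [hswap]
  rw [coneLaw_eq_map hmem, lintegral_map hR.lintegral_prod_right' measurable_toConeExtended]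
  -- The left integrand is `atomFunction F` by definition, whose integral against η is measurable in
  -- η because `coneKernel` is s-finite.
  refine (lintegral_map ((measurable_atomFunction hF).lintegral_kernel_prod_right'
    (κ := coneKernel X)) measurable_toConeExtended).trans ?_
  calc ∫⁻ γ, ∫⁻ x, atomFunction F (toConeExtended γ, x) ∂(toConeExtended γ).toMeasure ∂π
      = ∫⁻ γ, ∫⁻ p, ENNReal.ofReal (p.1 : ℝ) * F (toConeExtended γ, p) ∂γ.toMeasure ∂π :=
        lintegral_congr_ae (hmem.mono fun γ hγ => lintegral_atomFunction_toConeExtended hF hγ)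
    _ = ∫⁻ γ, ∫⁻ p, ENNReal.ofReal (p.1 : ℝ) * F (toConeExtended (γ.insertPoint p), p)
          ∂ν.prod σ ∂π := hπ.lintegral_lintegral_toMeasure hG
    _ = _ := by
      refine lintegral_congr_ae (hmem.mono fun γ hγ => lintegral_congr_ae ?_)
      -- Almost every inserted point has a new location, where inserting it into γ is adding an atom
      -- to the image.
      filter_upwards [γ.ae_snd_notMem (ν := ν) (σ := σ)] with p hp
      rw [toConeExtended_insertPoint hγ hp]
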